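/- A polytope is the convex hull of a finite set of points in some $\mathbb{R}^n$, and a $d$-polytope is a polytope of dimension $d$. A polytope $P$ is 2-level if every hyperplane $H$ that is facet-defining for $P$ has a parallel hyperplane $H'$ that contains all vertices of $P$ not contained in $H$. A suspension of a polytope $P_0\subseteq\{x\in\mathbb{R}^n\mid x_1=0\}$ is any polytope $P=\mathrm{conv}(P_0\cup P_1)$, where $P_1\subseteq\{x\in\mathbb{R}^n\mid x_1=1\}$ is a translate of some non-empty face of $P_0$. Two polytopes are combinatorially equivalent (have the same combinatorial type) if their face lattices are isomorphic. Let $\ell(d)$ be the number of combinatorial types of 2-level $d$-polytopes, and let $s(d)$ be the number of combinatorial types of 2-level suspensions of dimension $d$. Proposition. The numbers $\ell(d)$ and $s(d)$ are finite for every $d\ge 0$. If $\ell(d)=\Theta(s(d))$ as $d\to\infty$, then there is a constant $c>1$ such that $\ell(d)\le c^{d^3}$ for every $d\ge 0$; in particular $\ell(d)\le 2^{\mathrm{poly}(d)}$, that is, there is a polynomial $p$ with coefficients in $\mathbb{N}$ such that $\ell(d)\le 2^{p(d)}$ for every $d\ge 0$. -/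

import Mathlib

namespace TwoLevel

/-- A (convex) polytope in `ℝⁿ`: the convex hull of a finite set of points. -/
def IsPolytope {n : ℕ} (P : Set (Fin n → ℝ)) : Prop :=
  ∃ S : Finset (Fin n → ℝ), P = convexHull ℝ (S : Set (Fin n → ℝ))

open Classical in
/-- The dimension of `P`: the dimension of its affine hull, with the convention `dim ∅ = -1`. -/
noncomputable def dim {n : ℕ} (P : Set (Fin n → ℝ)) : ℤ :=
  if P = ∅ then -1 else (Module.finrank ℝ (affineSpan ℝ P).direction : ℤ)

/-- Faces of a polytope `P`: the empty set and the sets of maximizers over `P` of a linear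
functional. Both `∅` and `P` itself are faces. -/
def IsFace {n : ℕ} (P F : Set (Fin n → ℝ)) : Prop := IsExposed ℝ P F

/-- A facet is a face of codimension one. -/
def IsFacet {n : ℕ} (P F : Set (Fin n → ℝ)) : Prop :=
  IsFace P F ∧ dim F = dim P - 1

/-- `P` is 2-level if every facet-defining hyperplane `H = {g = 0}` (where `g ≥ 0` is valid for `P`)
has a parallel hyperplane `{g = t}` that contains all vertices of `P` not contained in `H`.
(If `P` has dimension at least one, a form `g` as below is never constant; if `P` is a point, the
condition holds trivially.) -/
def IsTwoLevel {n : ℕ} (P : Set (Fin n → ℝ)) : Prop :=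
  ∀ g : (Fin n → ℝ) →ᵃ[ℝ] ℝ, (∀ x ∈ P, 0 ≤ g x) → IsFacet P {x ∈ P | g x = 0} →
    ∃ t : ℝ, ∀ v ∈ P.extremePoints ℝ, g v ≠ 0 → g v = t

/-- `P ⊆ ℝⁿ` is a suspension: `P = conv (P₀ ∪ P₁)` with `P₀ ⊆ {x₁ = 0}` a polytope and
`P₁ ⊆ {x₁ = 1}` a translate `t + F` of a non-empty face `F` of `P₀`.
The first coordinate `x₁` is the one with index `i = 0` (so that `n ≥ 1`). -/
def IsSuspension {n : ℕ} (P : Set (Fin n → ℝ)) : Prop :=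
  ∃ i : Fin n, (i : ℕ) = 0 ∧ ∃ P₀ P₁ F : Set (Fin n → ℝ), ∃ t : Fin n → ℝ,
    IsPolytope P₀ ∧ P₀ ⊆ {x | x i = 0} ∧
    IsFace P₀ F ∧ F.Nonempty ∧
    P₁ = (fun x => t + x) '' F ∧ P₁ ⊆ {x | x i = 1} ∧
    P = convexHull ℝ (P₀ ∪ P₁)

/-- A polytope in some `ℝⁿ`. -/
structure Polytope where
  /-- the dimension of the ambient space -/
  n : ℕ
  /-- the set of points -/
  carrier : Set (Fin n → ℝ)
  isPolytope : IsPolytope carrier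

/-- The face lattice of a polytope: its faces, ordered by inclusion. -/
abbrev Polytope.FaceLattice (P : Polytope) : Type :=
  {F : Set (Fin P.n → ℝ) // IsFace P.carrier F}

/-- Two polytopes are combinatorially equivalent if their face lattices are isomorphic. -/
instance combSetoid : Setoid Polytope where
  r P Q := Nonempty (P.FaceLattice ≃o Q.FaceLattice)
  iseqv :=
    { refl := fun _ => ⟨OrderIso.refl _⟩
      symm := fun ⟨e⟩ => ⟨e.symm⟩
      trans := fun ⟨e⟩ ⟨f⟩ => ⟨e.trans f⟩ }

/-- Combinatorial types of polytopes. -/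
abbrev CombType : Type := Quotient combSetoid

/-- The combinatorial types of 2-level `d`-polytopes. -/
def twoLevelTypes (d : ℕ) : Set CombType :=
  Quotient.mk combSetoid '' {P | dim P.carrier = d ∧ IsTwoLevel P.carrier}

/-- The combinatorial types of 2-level suspensions of dimension `d`. -/
def suspensionTypes (d : ℕ) : Set CombType :=
  Quotient.mk combSetoid ''
    {P | dim P.carrier = d ∧ IsTwoLevel P.carrier ∧ IsSuspension P.carrier}

/-- `ℓ(d)`: the number of combinatorially distinct 2-level `d`-polytopes. -/
noncomputable def ell (d : ℕ) : ℕ := (twoLevelTypes d).ncard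

/-- `s(d)`: the number of combinatorially distinct 2-level suspensions of dimension `d`. -/
noncomputable def susp (d : ℕ) : ℕ := (suspensionTypes d).ncard

end TwoLevel

/-!
A suspension is determined up to affine isomorphism by its base `P₀` and the chosen face of `P₀`, and
the base of a 2-level suspension of dimension `d + 1` is a 2-level `d`-polytope. Hence
`s(d + 1) ≤ ℓ(d) · N(d)`, where `N(d)` bounds the number of non-empty faces of a 2-level
`d`-polytope. Together with `ℓ = O(s)` and `N(d) ≤ 2 ^ (d * (d + 1))` this gives a recursion for
`ℓ` whose solution is of the form `c ^ d ^ 3`: the exponents `d * (d + 1)` sum to at most a cubic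
(`exists_cubic_bound`).

The bound on `N(d)`, and the finiteness of `ℓ(d)`, come from 0/1 coordinates. A facet of a 2-level
polytope has a defining form with values in `{0, 1}` on the vertices, and the facet normals span the
dual of the direction space of the affine hull (`exists_isFacet_of_ne_zero`, obtained by rotating a
supporting hyperplane until it defines a facet). So `d` of these forms are affine coordinates that
identify the polytope with a 0/1 polytope in `ℝᵈ` (`IsTwoLevel.exists_coordinates`). A face of such
a polytope is its intersection with the affine hull of at most `d + 1` of its vertices.

The suspension over a given face is not determined by the *combinatorial* type of the base in
general: for a quadrilateral base and an edge of it, it matters whether the opposite edge is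
parallel. The counting therefore rests on the rigidity of 2-level polytopes
(`exists_affIso_of_combEquiv`): the 0/1 coordinates of the vertices are the vertex-facet incidences,
which can be read off from the face lattice, so combinatorially equivalent 2-level polytopes are
affinely isomorphic. This allows fixing one 0/1 representative for each combinatorial type of bases
and recording the face inside it (`susp_succ_le`).
-/

/-! ### Affine isomorphisms of point sets -/

namespace TwoLevel

variable {n m k d : ℕ}

/-- The affine maps `φ` and `ψ` restrict to mutually inverse bijections between `P ⊆ ℝⁿ` and
`Q ⊆ ℝᵐ`. The two maps are defined on the ambient spaces, which may have different dimensions, and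
need not be inverse to each other outside the affine hulls of `P` and `Q`. -/
def AffIso (P : Set (Fin n → ℝ)) (Q : Set (Fin m → ℝ))
    (φ : (Fin n → ℝ) →ᵃ[ℝ] (Fin m → ℝ)) (ψ : (Fin m → ℝ) →ᵃ[ℝ] (Fin n → ℝ)) : Prop :=
  φ '' P = Q ∧ ∀ x ∈ P, ψ (φ x) = x

namespace AffIso

variable {P F : Set (Fin n → ℝ)} {Q : Set (Fin m → ℝ)} {R : Set (Fin k → ℝ)}
  {φ : (Fin n → ℝ) →ᵃ[ℝ] (Fin m → ℝ)} {ψ : (Fin m → ℝ) →ᵃ[ℝ] (Fin n → ℝ)}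
  {φ' : (Fin m → ℝ) →ᵃ[ℝ] (Fin k → ℝ)} {ψ' : (Fin k → ℝ) →ᵃ[ℝ] (Fin m → ℝ)}

theorem symm_image (h : AffIso P Q φ ψ) (hF : F ⊆ P) : ψ '' (φ '' F) = F := by
  rw [Set.image_image]
  calc (fun x => ψ (φ x)) '' F = id '' F := Set.image_congr fun x hx => h.2 x (hF hx)
    _ = F := Set.image_id F

protected theorem symm (h : AffIso P Q φ ψ) : AffIso Q P ψ φ := by
  obtain ⟨rfl, h2⟩ := id h
  refine ⟨h.symm_image subset_rfl, ?_⟩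
  rintro _ ⟨x, hx, rfl⟩
  rw [h2 x hx]

protected theorem trans (h : AffIso P Q φ ψ) (h' : AffIso Q R φ' ψ') :
    AffIso P R (φ'.comp φ) (ψ.comp ψ') := by
  obtain ⟨rfl, h2⟩ := h
  obtain ⟨rfl, h3⟩ := h'
  refine ⟨by rw [AffineMap.coe_comp, Set.image_comp], fun x hx => ?_⟩
  simp only [AffineMap.comp_apply]
  rw [h3 _ (Set.mem_image_of_mem _ hx), h2 x hx]

theorem restrict (h : AffIso P Q φ ψ) (hF : F ⊆ P) : AffIso F (φ '' F) φ ψ :=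
  ⟨rfl, fun x hx => h.2 x (hF hx)⟩

theorem isFace_image (h : AffIso P Q φ ψ) (hF : IsFace P F) : IsFace Q (φ '' F) := by
  rintro ⟨_, x₀, hx₀, rfl⟩
  obtain ⟨l, rfl⟩ := hF ⟨x₀, hx₀⟩
  obtain ⟨rfl, h2⟩ := h
  have key : ∀ x y, l (ψ.linear x) ≤ l (ψ.linear y) ↔ l (ψ x) ≤ l (ψ y) := by
    intro x y
    have hx : ψ x = ψ.linear x + ψ 0 := congrFun (AffineMap.decomp ψ) x
    have hy : ψ y = ψ.linear y + ψ 0 := congrFun (AffineMap.decomp ψ) y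
    rw [hx, hy, map_add, map_add]
    exact (add_le_add_iff_right _).symm
  refine ⟨LinearMap.toContinuousLinearMap (l.toLinearMap ∘ₗ ψ.linear), ?_⟩
  ext z
  constructor
  · rintro ⟨x, ⟨hx, hmax⟩, rfl⟩
    refine ⟨⟨x, hx, rfl⟩, ?_⟩
    rintro _ ⟨y, hy, rfl⟩
    refine (key _ _).2 ?_
    rw [h2 x hx, h2 y hy]
    exact hmax y hy
  · rintro ⟨⟨x, hx, rfl⟩, hmax⟩
    refine ⟨x, ⟨hx, fun y hy => ?_⟩, rfl⟩
    have := (key _ _).1 (hmax (φ y) ⟨y, hy, rfl⟩)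
    rwa [h2 x hx, h2 y hy] at this

end AffIso

theorem combEquiv_of_affIso {P Q : Polytope} {φ : (Fin P.n → ℝ) →ᵃ[ℝ] (Fin Q.n → ℝ)}
    {ψ : (Fin Q.n → ℝ) →ᵃ[ℝ] (Fin P.n → ℝ)} (h : AffIso P.carrier Q.carrier φ ψ) :
    (Quotient.mk combSetoid P) = Quotient.mk combSetoid Q := by
  refine Quotient.sound ⟨?_⟩
  exact
    { toFun := fun F => ⟨φ '' F.1, h.isFace_image F.2⟩
      invFun := fun F => ⟨ψ '' F.1, h.symm.isFace_image F.2⟩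
      left_inv := fun F => Subtype.ext (h.symm_image F.2.subset)
      right_inv := fun F => Subtype.ext (h.symm.symm_image F.2.subset)
      map_rel_iff' := by
        intro F G
        refine ⟨fun hFG => ?_, fun hFG => Set.image_mono hFG⟩
        have h1 : ψ '' (φ '' F.1) ⊆ ψ '' (φ '' G.1) := Set.image_mono hFG
        rwa [h.symm_image F.2.subset, h.symm_image G.2.subset] at h1 }

theorem exists_affIso_of_injective (P : Set (Fin n → ℝ)) (φ : (Fin n → ℝ) →ᵃ[ℝ] (Fin m → ℝ))
    (hφ : ∀ v ∈ vectorSpan ℝ P, φ.linear v = 0 → v = 0) : ∃ ψ, AffIso P (φ '' P) φ ψ := by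
  rcases P.eq_empty_or_nonempty with rfl | ⟨x₀, hx₀⟩
  · exact ⟨AffineMap.const ℝ _ 0, rfl, fun x hx => hx.elim⟩
  obtain ⟨L, hL⟩ := (φ.linear.domRestrict (vectorSpan ℝ P)).exists_leftInverse_of_injective
    (LinearMap.ker_eq_bot'.2 fun v hv => Subtype.ext (hφ v v.2 hv))
  refine ⟨((vectorSpan ℝ P).subtype ∘ₗ L).toAffineMap.comp
    (AffineMap.id ℝ _ - AffineMap.const ℝ _ (φ x₀)) + AffineMap.const ℝ _ x₀, rfl, fun x hx => ?_⟩
  have h1 : x -ᵥ x₀ ∈ vectorSpan ℝ P := vsub_mem_vectorSpan ℝ hx hx₀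
  have h2 : L (φ.linear (x -ᵥ x₀)) = ⟨x -ᵥ x₀, h1⟩ := LinearMap.congr_fun hL ⟨x -ᵥ x₀, h1⟩
  have h3 : φ x - φ x₀ = φ.linear (x -ᵥ x₀) := (φ.linearMap_vsub x x₀).symm
  change ((L (φ x - φ x₀) : vectorSpan ℝ P) : Fin n → ℝ) + x₀ = x
  rw [h3, h2]
  exact sub_add_cancel x x₀

/-! ### Faces of polytopes -/

theorem IsPolytope.isCompact {P : Set (Fin n → ℝ)} (hP : IsPolytope P) : IsCompact P := by
  obtain ⟨S, rfl⟩ := hP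
  exact S.finite_toSet.isCompact_convexHull ℝ

theorem IsPolytope.convex {P : Set (Fin n → ℝ)} (hP : IsPolytope P) : Convex ℝ P := by
  obtain ⟨S, rfl⟩ := hP
  exact convex_convexHull ℝ _

theorem IsPolytope.finite_extremePoints {P : Set (Fin n → ℝ)} (hP : IsPolytope P) :
    (P.extremePoints ℝ).Finite := by
  obtain ⟨S, rfl⟩ := hP
  exact S.finite_toSet.subset extremePoints_convexHull_subset

theorem convexHull_extremePoints_of_finite {P : Set (Fin n → ℝ)} (hP : IsCompact P)
    (hc : Convex ℝ P) (hf : (P.extremePoints ℝ).Finite) : convexHull ℝ (P.extremePoints ℝ) = P := by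
  rw [← (hf.isClosed_convexHull ℝ).closure_eq, closure_convexHull_extremePoints hP hc]

theorem IsPolytope.convexHull_extremePoints {P : Set (Fin n → ℝ)} (hP : IsPolytope P) :
    convexHull ℝ (P.extremePoints ℝ) = P :=
  convexHull_extremePoints_of_finite hP.isCompact hP.convex hP.finite_extremePoints

theorem isPolytope_convexHull {S : Set (Fin n → ℝ)} (hS : S.Finite) :
    IsPolytope (convexHull ℝ S) := ⟨hS.toFinset, by simp⟩

theorem IsFace.exists_affine {P F : Set (Fin n → ℝ)} (hF : IsFace P F) :
    ∃ g : (Fin n → ℝ) →ᵃ[ℝ] ℝ, (∀ x ∈ P, 0 ≤ g x) ∧ F = {x ∈ P | g x = 0} := by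
  rcases F.eq_empty_or_nonempty with rfl | ⟨x₀, hx₀⟩
  · refine ⟨AffineMap.const ℝ _ 1, by simp, by simp⟩
  obtain ⟨l, rfl⟩ := hF ⟨x₀, hx₀⟩
  refine ⟨AffineMap.const ℝ _ (l x₀) - l.toLinearMap.toAffineMap, ?_, ?_⟩
  · intro x hx
    simpa using hx₀.2 x hx
  · ext x
    simp only [Set.mem_ofPred_eq, AffineMap.coe_sub, Pi.sub_apply, AffineMap.const_apply,
      LinearMap.coe_toAffineMap, ContinuousLinearMap.coe_coe, sub_eq_zero]
    refine and_congr_right fun hx => ⟨fun h => le_antisymm (h _ hx₀.1) (hx₀.2 x hx), ?_⟩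
    intro h y hy
    exact h ▸ hx₀.2 y hy

theorem isFace_of_affine {P : Set (Fin n → ℝ)} {g : (Fin n → ℝ) →ᵃ[ℝ] ℝ}
    (hg : ∀ x ∈ P, 0 ≤ g x) : IsFace P {x ∈ P | g x = 0} := by
  rintro ⟨x₀, hx₀, h0⟩
  have key : ∀ x, g x = g.linear x + g 0 := fun x => congrFun (AffineMap.decomp g) x
  refine ⟨LinearMap.toContinuousLinearMap (-g.linear), ?_⟩
  ext x
  simp only [Set.mem_ofPred_eq, LinearMap.coe_toContinuousLinearMap', LinearMap.neg_apply,
    neg_le_neg_iff]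
  refine and_congr_right fun hx => ⟨fun h y hy => ?_, fun h => ?_⟩
  · have := hg y hy
    rw [key] at this h
    linarith
  · have h1 := h x₀ hx₀
    have h2 := hg x hx
    rw [key] at h0 h2 ⊢
    linarith

theorem IsFace.finite_extremePoints {P F : Set (Fin n → ℝ)} (hP : IsPolytope P)
    (hF : IsFace P F) : (F.extremePoints ℝ).Finite := by
  rw [hF.isExtreme.extremePoints_eq]
  exact hP.finite_extremePoints.subset Set.inter_subset_right

theorem IsFace.convexHull_inter {P F : Set (Fin n → ℝ)} (hP : IsPolytope P) (hF : IsFace P F) :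
    convexHull ℝ (F ∩ P.extremePoints ℝ) = F := by
  rw [← hF.isExtreme.extremePoints_eq]
  exact convexHull_extremePoints_of_finite (hF.isCompact hP.isCompact) (hF.convex hP.convex)
    (hF.finite_extremePoints hP)

theorem IsFace.inter_affineSpan {P F : Set (Fin n → ℝ)} (hF : IsFace P F) :
    P ∩ affineSpan ℝ F = F := by
  refine subset_antisymm ?_ fun x hx => ⟨hF.subset hx, subset_affineSpan ℝ F hx⟩
  obtain ⟨g, hg, rfl⟩ := hF.exists_affine
  rintro x ⟨hx, hx'⟩
  refine ⟨hx, ?_⟩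
  have h1 : g x ∈ (affineSpan ℝ {x ∈ P | g x = 0}).map g := ⟨x, hx', rfl⟩
  rw [AffineSubspace.map_span] at h1
  have h2 : affineSpan ℝ (g '' {x ∈ P | g x = 0}) ≤ affineSpan ℝ {(0 : ℝ)} := by
    apply affineSpan_mono
    rintro _ ⟨y, hy, rfl⟩
    exact hy.2
  simpa using h2 h1

/-- A vertex of a polytope is strictly separated from the hull of the other vertices, so it forms a
face. -/
theorem isFace_singleton {P : Set (Fin n → ℝ)} (hP : IsPolytope P) {v : Fin n → ℝ}
    (hv : v ∈ P.extremePoints ℝ) : IsFace P {v} := by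
  have hfin : (P.extremePoints ℝ \ {v}).Finite := hP.finite_extremePoints.subset Set.sdiff_subset
  have hsub : convexHull ℝ (P.extremePoints ℝ \ {v}) ⊆ P :=
    (convexHull_mono Set.sdiff_subset).trans hP.convexHull_extremePoints.subset
  have hnot : v ∉ convexHull ℝ (P.extremePoints ℝ \ {v}) := fun h =>
    (extremePoints_convexHull_subset
      (inter_extremePoints_subset_extremePoints_of_subset hsub ⟨h, hv⟩)).2 rfl
  obtain ⟨l, u, hl, hu⟩ := geometric_hahn_banach_closed_point (convex_convexHull ℝ _)
    (hfin.isClosed_convexHull ℝ) hnot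
  have hle : ∀ x ∈ P.extremePoints ℝ, l x ≤ l v := by
    intro x hx
    by_cases hxv : x = v
    · rw [hxv]
    · exact ((hl x (subset_convexHull ℝ _ ⟨hx, hxv⟩)).trans hu).le
  have hleP : ∀ x ∈ P, l x ≤ l v := by
    intro x hx
    rw [← hP.convexHull_extremePoints] at hx
    exact convexHull_min hle (convex_halfSpace_le l.toLinearMap.isLinear (l v)) hx
  have hface : IsFace P (l.toExposed P) := ContinuousLinearMap.toExposed.isExposed
  have h1 : l.toExposed P ∩ P.extremePoints ℝ = {v} := by
    ext x
    constructor
    · rintro ⟨⟨_, hmax⟩, hx⟩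
      by_contra hxv
      exact absurd (hmax v hv.1) (not_le.2 ((hl x (subset_convexHull ℝ _ ⟨hx, hxv⟩)).trans hu))
    · rintro rfl
      exact ⟨⟨hv.1, hleP⟩, hv⟩
  have h2 := hface.convexHull_inter hP
  rw [h1, convexHull_singleton] at h2
  rwa [h2]

theorem IsFace.exists_vertex {P F : Set (Fin n → ℝ)} (hP : IsPolytope P) (hF : IsFace P F)
    (hne : F.Nonempty) : ∃ v ∈ P.extremePoints ℝ, v ∈ F := by
  rw [← hF.convexHull_inter hP, convexHull_nonempty_iff] at hne
  obtain ⟨v, hv⟩ := hne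
  exact ⟨v, hv.2, hv.1⟩

theorem dim_eq_finrank {P : Set (Fin n → ℝ)} (h : P.Nonempty) :
    dim P = Module.finrank ℝ (vectorSpan ℝ P) := by
  rw [dim, if_neg h.ne_empty, direction_affineSpan]

theorem dim_empty : dim (∅ : Set (Fin n → ℝ)) = -1 := if_pos rfl

theorem IsFace.finrank_lt {P F : Set (Fin n → ℝ)} (hF : IsFace P F) (hne : F.Nonempty)
    (hFP : F ≠ P) : Module.finrank ℝ (vectorSpan ℝ F) < Module.finrank ℝ (vectorSpan ℝ P) := by
  refine Submodule.finrank_lt_finrank_of_lt (lt_of_le_of_ne (vectorSpan_mono ℝ hF.subset) ?_)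
  intro h
  apply hFP
  rw [← hF.inter_affineSpan]
  have h1 : affineSpan ℝ F = affineSpan ℝ P := by
    refine AffineSubspace.eq_of_direction_eq_of_nonempty_of_le ?_ ?_
      (affineSpan_mono ℝ hF.subset)
    · rw [direction_affineSpan, direction_affineSpan, h]
    · exact hne.mono (subset_affineSpan ℝ F)
  rw [h1]
  exact (Set.inter_eq_left.2 (subset_affineSpan ℝ P))

theorem IsFace.dim_lt {P F : Set (Fin n → ℝ)} (hF : IsFace P F) (hFP : F ≠ P) :
    dim F < dim P := by
  have hP : P.Nonempty := by
    by_contra h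
    rw [Set.not_nonempty_iff_eq_empty] at h
    subst h
    exact hFP (Set.subset_empty_iff.1 hF.subset)
  rcases F.eq_empty_or_nonempty with rfl | hne
  · rw [dim_empty, dim_eq_finrank hP]
    omega
  · rw [dim_eq_finrank hP, dim_eq_finrank hne]
    exact_mod_cast hF.finrank_lt hne hFP

theorem IsFace.of_subset {P F G : Set (Fin n → ℝ)} (hF : IsFace P F) (hFG : F ⊆ G) (hGP : G ⊆ P) :
    IsFace G F := by
  obtain ⟨g, hg, rfl⟩ := hF.exists_affine
  have : {x ∈ P | g x = 0} = {x ∈ G | g x = 0} :=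
    Set.Subset.antisymm (fun x hx => ⟨hFG hx, hx.2⟩) fun x hx => ⟨hGP hx.1, hx.2⟩
  rw [this]
  exact isFace_of_affine fun x hx => hg x (hGP hx)

theorem IsFacet.ne {P F : Set (Fin n → ℝ)} (hF : IsFacet P F) : F ≠ P := by
  rintro rfl
  have := hF.2
  omega

/-- Facets are maximal among the proper faces. -/
theorem IsFacet.eq_of_subset {P F G : Set (Fin n → ℝ)} (hF : IsFacet P F) (hG : IsFace P G)
    (hGP : G ≠ P) (hFG : F ⊆ G) : F = G := by
  by_contra hne
  have h1 := (hF.1.of_subset hFG hG.subset).dim_lt hne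
  have h2 := hG.dim_lt hGP
  have h3 := hF.2
  omega

/-! ### Rotating a supporting hyperplane onto a facet -/

theorem affine_nonneg_of_vertices {P : Set (Fin n → ℝ)} (hP : IsPolytope P)
    {g : (Fin n → ℝ) →ᵃ[ℝ] ℝ} (hg : ∀ x ∈ P.extremePoints ℝ, 0 ≤ g x) : ∀ x ∈ P, 0 ≤ g x := by
  intro x hx
  rw [← hP.convexHull_extremePoints] at hx
  exact convexHull_min hg ((convex_Ici (0 : ℝ)).affine_preimage g) hx

theorem affine_eq_zero_of_vertices {P : Set (Fin n → ℝ)} (hP : IsPolytope P)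
    {g : (Fin n → ℝ) →ᵃ[ℝ] ℝ} (hg : ∀ x ∈ P.extremePoints ℝ, g x = 0) : ∀ x ∈ P, g x = 0 := by
  intro x hx
  rw [← hP.convexHull_extremePoints] at hx
  exact convexHull_min hg ((convex_singleton (0 : ℝ)).affine_preimage g) hx

theorem vectorSpan_le_ker {P : Set (Fin n → ℝ)} {g : (Fin n → ℝ) →ᵃ[ℝ] ℝ} {c : ℝ}
    (hg : ∀ x ∈ P, g x = c) : vectorSpan ℝ P ≤ LinearMap.ker g.linear := by
  rw [vectorSpan, Submodule.span_le]
  rintro _ ⟨x, hx, y, hy, rfl⟩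
  change g.linear (x -ᵥ y) = 0
  rw [AffineMap.linearMap_vsub, hg x hx, hg y hy, vsub_self]

/-- Adding to a valid form `g` the largest admissible multiple of a form `h` that vanishes wherever
`g` does makes a further point of the finite set `V` tight. -/
theorem exists_tilt {V : Set (Fin n → ℝ)} (hV : V.Finite) {g h : (Fin n → ℝ) →ᵃ[ℝ] ℝ}
    (hg : ∀ x ∈ V, 0 ≤ g x) (hz : ∀ x ∈ V, g x = 0 → h x = 0) (hneg : ∃ x ∈ V, h x < 0) :
    ∃ c : ℝ, (∀ x ∈ V, 0 ≤ g x + c * h x) ∧ ∃ x ∈ V, g x ≠ 0 ∧ g x + c * h x = 0 := by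
  obtain ⟨x₀, ⟨hx₀, hn⟩, hmin⟩ := Set.exists_min_image {x ∈ V | h x < 0}
    (fun x => g x / (-h x)) (hV.subset fun x hx => hx.1) hneg
  refine ⟨g x₀ / (-h x₀), fun x hx => ?_, x₀, hx₀, fun h0 => ?_, ?_⟩
  · rcases lt_or_ge (h x) 0 with hlt | hge
    · have h1 := hmin x ⟨hx, hlt⟩
      have h2 := (le_div_iff₀ (neg_pos.2 hlt)).1 h1
      linarith
    · exact add_nonneg (hg x hx)
        (mul_nonneg (div_nonneg (hg x₀ hx₀) (neg_nonneg.2 hn.le)) hge)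
  · exact hn.ne (hz x₀ hx₀ h0)
  · have : h x₀ ≠ 0 := hn.ne
    field_simp
    ring

/-- Below a face of codimension at least two there is enough room for a form that vanishes on the
face, is constant in one prescribed direction, and does not vanish on the polytope. -/
theorem exists_affine_of_not_isFacet {P F : Set (Fin n → ℝ)} (hF : IsFace P F)
    (hFP : F ≠ P) (hnf : ¬ IsFacet P F) (v : Fin n → ℝ) :
    ∃ h : (Fin n → ℝ) →ᵃ[ℝ] ℝ, (∀ x ∈ F, h x = 0) ∧ h.linear v = 0 ∧ ∃ x ∈ P, h x ≠ 0 := by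
  have hlt := hF.dim_lt hFP
  have hne : dim F ≠ dim P - 1 := fun h => hnf ⟨hF, h⟩
  have hP : P.Nonempty := by
    by_contra h
    rw [Set.not_nonempty_iff_eq_empty] at h
    subst h
    exact hFP (Set.subset_empty_iff.1 hF.subset)
  rcases F.eq_empty_or_nonempty with rfl | ⟨x₀, hx₀⟩
  · obtain ⟨y, hy⟩ := hP
    exact ⟨AffineMap.const ℝ _ 1, by simp, by simp, y, hy, by simp⟩
  rw [dim_eq_finrank hP, dim_eq_finrank ⟨x₀, hx₀⟩] at hlt hne
  obtain ⟨u, hu, huW⟩ : ∃ u ∈ vectorSpan ℝ P, u ∉ vectorSpan ℝ F ⊔ Submodule.span ℝ {v} := by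
    by_contra! hcon
    have h1 := Submodule.finrank_mono (show vectorSpan ℝ P ≤ _ from hcon)
    have h2 := Submodule.finrank_add_le_finrank_add_finrank (vectorSpan ℝ F)
      (Submodule.span ℝ {v})
    have h3 : Module.finrank ℝ (Submodule.span ℝ {v}) ≤ 1 := by
      simpa using finrank_span_le_card (R := ℝ) ({v} : Set (Fin n → ℝ))
    omega
  obtain ⟨f, hfu, hf⟩ := Submodule.exists_le_ker_of_notMem huW
  refine ⟨f.toAffineMap - AffineMap.const ℝ _ (f x₀), fun x hx => ?_, ?_, ?_⟩
  · have : f (x -ᵥ x₀) = 0 := hf (Submodule.mem_sup_left (vsub_mem_vectorSpan ℝ hx hx₀))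
    simpa using this
  · have : f v = 0 := hf (Submodule.mem_sup_right (Submodule.mem_span_singleton_self v))
    simpa using this
  · by_contra! hcon
    have h1 := vectorSpan_le_ker hcon hu
    apply hfu
    simpa using h1

/-- Every supporting hyperplane can be rotated onto a facet in such a way that the derivative of the
defining form in a prescribed direction does not change; in particular it stays non-zero. -/
theorem exists_isFacet_of_affine {P : Set (Fin n → ℝ)} (hP : IsPolytope P) {v : Fin n → ℝ}
    (hv : v ∈ vectorSpan ℝ P) (g : (Fin n → ℝ) →ᵃ[ℝ] ℝ) (hg : ∀ x ∈ P, 0 ≤ g x)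
    (hgv : g.linear v ≠ 0) :
    ∃ g' : (Fin n → ℝ) →ᵃ[ℝ] ℝ, (∀ x ∈ P, 0 ≤ g' x) ∧ {x ∈ P | g x = 0} ⊆ {x ∈ P | g' x = 0} ∧
      g'.linear v ≠ 0 ∧ IsFacet P {x ∈ P | g' x = 0} := by
  induction hN : {x ∈ P.extremePoints ℝ | g x ≠ 0}.ncard using Nat.strong_induction_on
    generalizing g with
  | _ N ih =>
  by_cases hfac : IsFacet P {x ∈ P | g x = 0}
  · exact ⟨g, hg, subset_rfl, hgv, hfac⟩
  have hproper : {x ∈ P | g x = 0} ≠ P := by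
    intro h
    refine hgv (vectorSpan_le_ker (c := 0) (fun x hx => ?_) hv)
    rw [← h] at hx
    exact hx.2
  obtain ⟨h, hh0, hhv, hhP⟩ := exists_affine_of_not_isFacet (isFace_of_affine hg) hproper hfac v
  -- Up to a change of sign, `h` is negative at some vertex.
  obtain ⟨h, hh0, hhv, hneg⟩ : ∃ h : (Fin n → ℝ) →ᵃ[ℝ] ℝ, (∀ x ∈ {x ∈ P | g x = 0}, h x = 0) ∧
      h.linear v = 0 ∧ ∃ x ∈ P.extremePoints ℝ, h x < 0 := by
    by_cases hn : ∃ x ∈ P.extremePoints ℝ, h x < 0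
    · exact ⟨h, hh0, hhv, hn⟩
    push Not at hn
    refine ⟨-h, fun x hx => by simp [hh0 x hx], by simp [hhv], ?_⟩
    by_contra! hcon
    obtain ⟨x, hx, hx0⟩ := hhP
    refine hx0 (affine_eq_zero_of_vertices hP (fun y hy => le_antisymm ?_ (hn y hy)) x hx)
    simpa using hcon y hy
  obtain ⟨c, hc, w, hw, hgw, hw0⟩ := exists_tilt hP.finite_extremePoints
    (fun x hx => hg x hx.1) (fun x hx h0 => hh0 x ⟨hx.1, h0⟩) hneg
  have hval : ∀ x, (g + c • h) x = g x + c * h x := fun x => by simp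
  have hg' : ∀ x ∈ P, 0 ≤ (g + c • h) x :=
    affine_nonneg_of_vertices hP fun x hx => by rw [hval]; exact hc x hx
  have hsub : {x ∈ P | g x = 0} ⊆ {x ∈ P | (g + c • h) x = 0} := by
    rintro x ⟨hx, hx0⟩
    refine ⟨hx, ?_⟩
    rw [hval, hx0, hh0 x ⟨hx, hx0⟩, mul_zero, add_zero]
  have hlt : {x ∈ P.extremePoints ℝ | (g + c • h) x ≠ 0}.ncard < N := by
    rw [← hN]
    refine Set.ncard_lt_ncard ⟨fun x hx => ⟨hx.1, fun h0 => hx.2 (hsub ⟨hx.1.1, h0⟩).2⟩, ?_⟩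
      (hP.finite_extremePoints.subset fun x hx => hx.1)
    intro hcon
    refine (hcon ⟨hw, hgw⟩).2 ?_
    rw [hval, hw0]
  obtain ⟨g', h1, h2, h3⟩ := ih _ hlt (g + c • h) hg' (by simpa [hhv] using hgv) rfl
  exact ⟨g', h1, hsub.trans h2, h3⟩

/-- The facet normals of a polytope separate the directions of its affine hull. -/
theorem exists_isFacet_of_ne_zero {P : Set (Fin n → ℝ)} (hP : IsPolytope P) {v : Fin n → ℝ}
    (hv : v ∈ vectorSpan ℝ P) (hv0 : v ≠ 0) :
    ∃ g : (Fin n → ℝ) →ᵃ[ℝ] ℝ, (∀ x ∈ P, 0 ≤ g x) ∧ g.linear v ≠ 0 ∧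
      IsFacet P {x ∈ P | g x = 0} := by
  obtain ⟨f, hf⟩ : ∃ f : Module.Dual ℝ (Fin n → ℝ), f v ≠ 0 := by
    by_contra! hcon
    exact hv0 ((Module.forall_dual_apply_eq_zero_iff ℝ v).1 hcon)
  obtain ⟨c, hc⟩ := (hP.isCompact.image (LinearMap.continuous_of_finiteDimensional f)).bddBelow
  obtain ⟨g, h1, -, h2, h3⟩ := exists_isFacet_of_affine hP hv
    (f.toAffineMap - AffineMap.const ℝ _ c)
    (fun x hx => by simpa using hc (Set.mem_image_of_mem f hx)) (by simpa using hf)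
  exact ⟨g, h1, h2, h3⟩

theorem IsFace.exists_isFacet {P F : Set (Fin n → ℝ)} (hP : IsPolytope P) (hF : IsFace P F)
    (hFP : F ≠ P) : ∃ G, IsFacet P G ∧ F ⊆ G := by
  obtain ⟨y, hy, hyF⟩ : ∃ y ∈ P, y ∉ F := by
    by_contra! hcon
    exact hFP (hF.subset.antisymm hcon)
  rcases F.eq_empty_or_nonempty with rfl | ⟨x, hx⟩
  · by_cases h0 : vectorSpan ℝ P = ⊥
    · refine ⟨∅, ⟨hF, ?_⟩, subset_rfl⟩
      rw [dim_empty, dim_eq_finrank ⟨y, hy⟩, h0, finrank_bot]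
      simp
    · obtain ⟨v, hv, hv0⟩ := Submodule.exists_mem_ne_zero_of_ne_bot h0
      obtain ⟨g, -, -, h⟩ := exists_isFacet_of_ne_zero hP hv hv0
      exact ⟨_, h, Set.empty_subset _⟩
  · obtain ⟨g, hg, rfl⟩ := hF.exists_affine
    have hgy : g.linear (y -ᵥ x) ≠ 0 := by
      rw [AffineMap.linearMap_vsub, hx.2]
      intro h
      exact hyF ⟨hy, by simpa using h⟩
    obtain ⟨g', -, h1, -, h2⟩ := exists_isFacet_of_affine hP
      (vsub_mem_vectorSpan ℝ hy hx.1) g hg hgy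
    exact ⟨_, h2, h1⟩

/-! ### Coordinates of 2-level polytopes -/

/-- In a 2-level polytope a facet-defining form can be scaled so that its values on the vertices
are `0` and `1`. -/
theorem IsTwoLevel.exists_normalized {P : Set (Fin n → ℝ)} (h2 : IsTwoLevel P)
    {g : (Fin n → ℝ) →ᵃ[ℝ] ℝ} (hg : ∀ x ∈ P, 0 ≤ g x) (hH : IsFacet P {x ∈ P | g x = 0}) :
    ∃ c : ℝ, c ≠ 0 ∧ ∀ v ∈ P.extremePoints ℝ, g v ≠ 0 → c * g v = 1 := by
  obtain ⟨t, ht⟩ := h2 g hg hH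
  rcases eq_or_ne t 0 with rfl | h0
  · exact ⟨1, one_ne_zero, fun v hv h => absurd (ht v hv h) h⟩
  · exact ⟨t⁻¹, inv_ne_zero h0, fun v hv h => by rw [ht v hv h, inv_mul_cancel₀ h0]⟩

/-- A 2-level `d`-polytope has `d` facets whose normalized defining forms are affine coordinates on
its affine hull; in these coordinates, the vertices are 0/1 points. -/
theorem IsTwoLevel.exists_coordinates {P : Set (Fin n → ℝ)} (hP : IsPolytope P)
    (h2 : IsTwoLevel P) {d : ℕ} (hd : dim P = d) :
    ∃ (H : Fin d → Set (Fin n → ℝ)) (G : (Fin n → ℝ) →ᵃ[ℝ] (Fin d → ℝ)),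
      (∀ i, IsFacet P (H i)) ∧
      (∀ v ∈ P.extremePoints ℝ, ∀ i, (v ∈ H i → G v i = 0) ∧ (v ∉ H i → G v i = 1)) ∧
      ∀ v ∈ vectorSpan ℝ P, G.linear v = 0 → v = 0 := by
  have hne : P.Nonempty := by
    by_contra h
    rw [Set.not_nonempty_iff_eq_empty] at h
    rw [h, dim_empty] at hd
    omega
  rw [dim_eq_finrank hne] at hd
  let s : Set (Module.Dual ℝ (vectorSpan ℝ P)) :=
    {f | ∃ (H : Set (Fin n → ℝ)) (g : (Fin n → ℝ) →ᵃ[ℝ] ℝ), IsFacet P H ∧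
      (∀ v ∈ P.extremePoints ℝ, (v ∈ H → g v = 0) ∧ (v ∉ H → g v = 1)) ∧
      f = g.linear.domRestrict (vectorSpan ℝ P)}
  have hsep : ∀ v : vectorSpan ℝ P, (∀ f ∈ s, f v = 0) → v = 0 := by
    rintro ⟨v, hv⟩ hs
    by_contra hv0
    obtain ⟨g, hg, hgv, hH⟩ := exists_isFacet_of_ne_zero hP hv fun h => hv0 (Subtype.ext h)
    obtain ⟨c, hc0, hc⟩ := h2.exists_normalized hg hH
    have h1 := hs ((c • g).linear.domRestrict (vectorSpan ℝ P)) ⟨_, c • g, hH, fun w hw =>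
      ⟨fun h => by simp [h.2], fun h => by simpa using hc w hw fun h0 => h ⟨hw.1, h0⟩⟩, rfl⟩
    have h3 : c * g.linear v = 0 := h1
    exact mul_ne_zero hc0 hgv h3
  have htop : Submodule.span ℝ s = ⊤ := by
    rw [← Subspace.dualCoannihilator_dualAnnihilator_eq (W := Submodule.span ℝ s)]
    have : (Submodule.span ℝ s).dualCoannihilator = ⊥ := by
      rw [Submodule.eq_bot_iff]
      intro v hv
      exact hsep v fun f hf => (Submodule.mem_dualCoannihilator v).1 hv f (Submodule.subset_span hf)
    rw [this, Submodule.dualAnnihilator_bot]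
  obtain ⟨f, hfs, hspan, -⟩ := Submodule.exists_fun_fin_finrank_span_eq ℝ s
  have hdim : Module.finrank ℝ (Submodule.span ℝ s) = d := by
    rw [htop, finrank_top, Subspace.dual_finrank_eq]
    exact_mod_cast hd
  subst hdim
  choose H g hH hgv hfg using hfs
  refine ⟨H, AffineMap.pi g, hH, fun v hv i => hgv i v hv, fun v hv h0 => ?_⟩
  have h1 : ∀ i, f i ⟨v, hv⟩ = 0 := by
    intro i
    rw [hfg i]
    exact congrFun h0 i
  have h3 : Submodule.span ℝ s ≤ LinearMap.ker (Module.Dual.eval ℝ (vectorSpan ℝ P) ⟨v, hv⟩) := by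
    rw [← hspan, Submodule.span_le]
    rintro _ ⟨i, rfl⟩
    exact h1 i
  exact congrArg Subtype.val (hsep ⟨v, hv⟩ fun f hf => h3 (Submodule.subset_span hf))

/-! ### Combinatorial type determines 2-level polytopes up to affine isomorphism -/

section FaceLattice

variable {P Q : Polytope} (e : P.FaceLattice ≃o Q.FaceLattice)

theorem nonempty_of_orderIso (F : P.FaceLattice) (hF : F.1.Nonempty) : (e F).1.Nonempty := by
  by_contra h
  rw [Set.not_nonempty_iff_eq_empty] at h
  have h1 : e F ≤ e ⟨∅, isExposed_empty⟩ := h.le.trans (Set.empty_subset _)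
  obtain ⟨x, hx⟩ := hF
  exact (e.le_iff_le.1 h1) hx

theorem ne_carrier_of_orderIso (F : P.FaceLattice) (hF : F.1 ≠ P.carrier) :
    (e F).1 ≠ Q.carrier := by
  intro h
  have h1 : e ⟨P.carrier, IsExposed.refl P.carrier⟩ ≤ e F :=
    (e ⟨P.carrier, IsExposed.refl P.carrier⟩).2.subset.trans h.ge
  exact hF (F.2.subset.antisymm (e.le_iff_le.1 h1))

theorem exists_vertex_of_orderIso {v : Fin P.n → ℝ} (hv : v ∈ P.carrier.extremePoints ℝ) :
    ∃ w ∈ Q.carrier.extremePoints ℝ, ∀ F : P.FaceLattice, v ∈ F.1 ↔ w ∈ (e F).1 := by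
  let V : P.FaceLattice := ⟨{v}, isFace_singleton P.isPolytope hv⟩
  obtain ⟨w, hw, hwV⟩ := (e V).2.exists_vertex Q.isPolytope
    (nonempty_of_orderIso e V (Set.singleton_nonempty v))
  let W : Q.FaceLattice := ⟨{w}, isFace_singleton Q.isPolytope hw⟩
  have h1 : W ≤ e V := Set.singleton_subset_iff.2 hwV
  have h2 : (e.symm W).1 ⊆ {v} := (e.symm_apply_le).2 h1
  have h3 : (e.symm W).1 = {v} := Set.Nonempty.subset_singleton_iff
    (nonempty_of_orderIso e.symm W (Set.singleton_nonempty w)) |>.1 h2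
  have h4 : e V = W := by
    rw [← e.apply_symm_apply W]
    exact congrArg e (Subtype.ext h3.symm)
  refine ⟨w, hw, fun F => ?_⟩
  calc v ∈ F.1 ↔ V ≤ F := Set.singleton_subset_iff.symm
    _ ↔ W ≤ e F := by rw [← h4, e.le_iff_le]
    _ ↔ w ∈ (e F).1 := Set.singleton_subset_iff

theorem isFacet_of_orderIso (F : P.FaceLattice) (hF : IsFacet P.carrier F.1) :
    IsFacet Q.carrier (e F).1 := by
  obtain ⟨G, hG, hFG⟩ := (e F).2.exists_isFacet Q.isPolytope (ne_carrier_of_orderIso e F hF.ne)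
  let G' : Q.FaceLattice := ⟨G, hG.1⟩
  have h1 : F ≤ e.symm G' := (e.le_symm_apply).2 hFG
  have h2 : F = e.symm G' := Subtype.ext
    (hF.eq_of_subset (e.symm G').2 (ne_carrier_of_orderIso e.symm G' hG.ne) h1)
  rw [h2, e.apply_symm_apply]
  exact hG

end FaceLattice

theorem map_vectorSpan_eq {P : Set (Fin n → ℝ)} (hP : IsPolytope P)
    (G : (Fin n → ℝ) →ᵃ[ℝ] (Fin d → ℝ)) :
    (vectorSpan ℝ P).map G.linear = vectorSpan ℝ (G '' P.extremePoints ℝ) := by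
  rw [← direction_affineSpan, ← direction_affineSpan, ← AffineSubspace.map_direction,
    AffineSubspace.map_span]
  conv_lhs => rw [← hP.convexHull_extremePoints, AffineMap.image_convexHull, affineSpan_convexHull]

theorem image_eq_convexHull {P : Set (Fin n → ℝ)} (hP : IsPolytope P)
    (G : (Fin n → ℝ) →ᵃ[ℝ] (Fin d → ℝ)) :
    G '' P = convexHull ℝ (G '' P.extremePoints ℝ) := by
  conv_lhs => rw [← hP.convexHull_extremePoints, AffineMap.image_convexHull]

/-- Combinatorially equivalent 2-level polytopes are affinely isomorphic: the facets and vertices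
chosen by `IsTwoLevel.exists_coordinates` are matched by the isomorphism of face lattices, and the
vertex-facet incidences are all the coordinates of the vertices. -/
theorem exists_affIso_of_combEquiv {P Q : Polytope} (hP : IsTwoLevel P.carrier)
    (hQ : IsTwoLevel Q.carrier) (hPd : dim P.carrier = d) (hQd : dim Q.carrier = d)
    (h : Quotient.mk combSetoid P = Quotient.mk combSetoid Q) :
    ∃ φ ψ, AffIso P.carrier Q.carrier φ ψ := by
  obtain ⟨e⟩ := Quotient.exact h
  obtain ⟨H, G, hH, hG, hinj⟩ := hP.exists_coordinates P.isPolytope hPd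
  have hg : ∀ i, ∃ g : (Fin Q.n → ℝ) →ᵃ[ℝ] ℝ, ∀ v ∈ Q.carrier.extremePoints ℝ,
      (v ∈ (e ⟨H i, (hH i).1⟩).1 → g v = 0) ∧ (v ∉ (e ⟨H i, (hH i).1⟩).1 → g v = 1) := by
    intro i
    have hf := isFacet_of_orderIso e ⟨H i, (hH i).1⟩ (hH i)
    obtain ⟨g, hg, hgH⟩ := hf.1.exists_affine
    rw [hgH] at hf ⊢
    obtain ⟨c, -, hc⟩ := hQ.exists_normalized hg hf
    exact ⟨c • g, fun v hv => ⟨fun h => by simp [h.2],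
      fun h => by simpa using hc v hv fun h0 => h ⟨hv.1, h0⟩⟩⟩
  choose g hg using hg
  let G' : (Fin Q.n → ℝ) →ᵃ[ℝ] (Fin d → ℝ) := AffineMap.pi g
  have hmatch : ∀ v ∈ P.carrier.extremePoints ℝ, ∀ w ∈ Q.carrier.extremePoints ℝ,
      (∀ F : P.FaceLattice, v ∈ F.1 ↔ w ∈ (e F).1) → G v = G' w := by
    intro v hv w hw hvw
    ext i
    change G v i = g i w
    by_cases hvi : v ∈ H i
    · rw [(hG v hv i).1 hvi, (hg i w hw).1 ((hvw ⟨H i, (hH i).1⟩).1 hvi)]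
    · rw [(hG v hv i).2 hvi, (hg i w hw).2 fun h => hvi ((hvw ⟨H i, (hH i).1⟩).2 h)]
  have himage : G '' P.carrier.extremePoints ℝ = G' '' Q.carrier.extremePoints ℝ := by
    ext y
    constructor
    · rintro ⟨v, hv, rfl⟩
      obtain ⟨w, hw, hvw⟩ := exists_vertex_of_orderIso e hv
      exact ⟨w, hw, (hmatch v hv w hw hvw).symm⟩
    · rintro ⟨w, hw, rfl⟩
      obtain ⟨v, hv, hvw⟩ := exists_vertex_of_orderIso e.symm hw
      refine ⟨v, hv, hmatch v hv w hw fun F => ?_⟩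
      have := hvw (e F)
      rw [e.symm_apply_apply] at this
      exact this.symm
  have hnePQ : P.carrier.Nonempty ∧ Q.carrier.Nonempty := by
    constructor <;>
    · by_contra h
      rw [Set.not_nonempty_iff_eq_empty] at h
      simp only [h, dim_empty] at hPd hQd
      omega
  have hrank : Module.finrank ℝ (vectorSpan ℝ P.carrier) =
      Module.finrank ℝ (vectorSpan ℝ Q.carrier) := by
    rw [dim_eq_finrank hnePQ.1] at hPd
    rw [dim_eq_finrank hnePQ.2] at hQd
    omega
  -- The images of the two direction spaces agree, so injectivity passes from `G` to `G'` by
  -- comparing dimensions.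
  have hinj' : ∀ v ∈ vectorSpan ℝ Q.carrier, G'.linear v = 0 → v = 0 := by
    have hker : LinearMap.ker (G.linear.domRestrict (vectorSpan ℝ P.carrier)) = ⊥ :=
      LinearMap.ker_eq_bot'.2 fun v hv => Subtype.ext (hinj v v.2 hv)
    have h1 := LinearMap.finrank_range_add_finrank_ker
      (G.linear.domRestrict (vectorSpan ℝ P.carrier))
    have h2 := LinearMap.finrank_range_add_finrank_ker
      (G'.linear.domRestrict (vectorSpan ℝ Q.carrier))
    rw [LinearMap.range_domRestrict, map_vectorSpan_eq P.isPolytope, hker, finrank_bot] at h1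
    rw [LinearMap.range_domRestrict, map_vectorSpan_eq Q.isPolytope, ← himage] at h2
    have hker' : LinearMap.ker (G'.linear.domRestrict (vectorSpan ℝ Q.carrier)) = ⊥ :=
      Submodule.finrank_eq_zero.1 (by omega)
    intro v hv h0
    exact congrArg Subtype.val (LinearMap.ker_eq_bot'.1 hker' ⟨v, hv⟩ h0)
  obtain ⟨ψ, hψ⟩ := exists_affIso_of_injective P.carrier G hinj
  obtain ⟨ψ', hψ'⟩ := exists_affIso_of_injective Q.carrier G' hinj'
  rw [image_eq_convexHull P.isPolytope, himage, ← image_eq_convexHull Q.isPolytope] at hψ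
  exact ⟨_, _, hψ.trans hψ'.symm⟩

/-! ### 0/1 polytopes -/

/-- The point of `ℝᵈ` with 0/1 coordinates given by `b`. -/
def cubePoint (b : Fin d → Bool) : Fin d → ℝ := fun i => if b i then 1 else 0

/-- The 0/1 polytope spanned by the vertices of the cube that belong to `T`. -/
def cubeHull (T : Set (Fin d → Bool)) : Set (Fin d → ℝ) := convexHull ℝ (cubePoint '' T)

theorem isPolytope_cubeHull (T : Set (Fin d → Bool)) : IsPolytope (cubeHull T) :=
  isPolytope_convexHull (T.toFinite.image _)

theorem IsTwoLevel.exists_affIso_cubeHull {P : Set (Fin n → ℝ)} (hP : IsPolytope P)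
    (h2 : IsTwoLevel P) (hd : dim P = d) :
    ∃ (T : Set (Fin d → Bool)) (φ : _) (ψ : _), AffIso P (cubeHull T) φ ψ := by
  classical
  obtain ⟨H, G, -, hG, hinj⟩ := h2.exists_coordinates hP hd
  obtain ⟨ψ, hψ⟩ := exists_affIso_of_injective P G hinj
  refine ⟨{b | cubePoint b ∈ G '' P.extremePoints ℝ}, G, ψ, ?_⟩
  have : cubePoint '' {b : Fin d → Bool | cubePoint b ∈ G '' P.extremePoints ℝ} =
      G '' P.extremePoints ℝ := by
    refine Set.Subset.antisymm (by rintro _ ⟨b, hb, rfl⟩; exact hb) ?_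
    rintro _ ⟨v, hv, rfl⟩
    have hb : cubePoint (fun i => decide (v ∉ H i)) = G v := by
      ext i
      by_cases hvi : v ∈ H i
      · simp [cubePoint, hvi, (hG v hv i).1 hvi]
      · simp [cubePoint, hvi, (hG v hv i).2 hvi]
    exact ⟨_, by rw [Set.mem_ofPred_eq, hb]; exact ⟨v, hv, rfl⟩, hb⟩
  rw [cubeHull, this, ← image_eq_convexHull hP]
  exact hψ

/-- A non-empty face of a 0/1 polytope in `ℝᵈ` is cut out by the affine hull of `d + 1` (not
necessarily distinct) 0/1 points. This bounds the number of faces by `2 ^ (d * (d + 1))`. -/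
theorem exists_face_eq_inter_affineSpan {T : Set (Fin d → Bool)} {F : Set (Fin d → ℝ)}
    (hF : IsFace (cubeHull T) F) (hne : F.Nonempty) :
    ∃ f : Fin (d + 1) → (Fin d → Bool),
      F = cubeHull T ∩ affineSpan ℝ (Set.range (cubePoint ∘ f)) := by
  have hP := isPolytope_cubeHull T
  obtain ⟨s, hs, hspan, hind⟩ :=
    exists_affineIndependent ℝ (Fin d → ℝ) (F ∩ (cubeHull T).extremePoints ℝ)
  have hsF : affineSpan ℝ s = affineSpan ℝ F := by
    rw [hspan]
    conv_rhs => rw [← hF.convexHull_inter hP, affineSpan_convexHull]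
  have hsne : s.Nonempty := by
    rw [← affineSpan_nonempty ℝ, hsF]
    exact hne.mono (subset_affineSpan ℝ F)
  have hsfin : s.Finite := hP.finite_extremePoints.subset fun x hx => (hs hx).2
  have hcube : ∀ x ∈ s, ∃ b, cubePoint b = x := by
    intro x hx
    obtain ⟨b, -, hb⟩ := extremePoints_convexHull_subset (hs hx).2
    exact ⟨b, hb⟩
  have : Fintype s := hsfin.fintype
  have : Nonempty s := hsne.to_subtype
  have hcard : Fintype.card s ≤ Fintype.card (Fin (d + 1)) := by
    have h1 : Fintype.card s ≤ _ := hind.card_le_finrank_succ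
    have h2 := Submodule.finrank_le (vectorSpan ℝ (Set.range ((↑) : s → (Fin d → ℝ))))
    rw [Module.finrank_fin_fun] at h2
    rw [Fintype.card_fin]
    omega
  obtain ⟨j⟩ := Function.Embedding.nonempty_of_card_le hcard
  choose b hb using hcube
  refine ⟨fun i => b _ (Function.invFun j i).2, ?_⟩
  have hrange : Set.range (cubePoint ∘ fun i => b _ (Function.invFun j i).2) = s := by
    ext x
    constructor
    · rintro ⟨i, rfl⟩
      simp only [Function.comp_apply, hb]
      exact (Function.invFun j i).2
    · intro hx
      refine ⟨j ⟨x, hx⟩, ?_⟩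
      simp only [Function.comp_apply, hb, Function.leftInverse_invFun j.injective ⟨x, hx⟩]
  rw [hrange, hsF, hF.inter_affineSpan]

/-! ### Suspensions -/

/-- The suspension of `P₀` over `F ⊆ P₀` with translation vector `t`. -/
def suspend (P₀ F : Set (Fin n → ℝ)) (t : Fin n → ℝ) : Set (Fin n → ℝ) :=
  convexHull ℝ (P₀ ∪ (fun x => t + x) '' F)

/-- The affine map that agrees with `φ` on the hyperplane `{x | x i = 0}` and whose linear part
sends `t` to `t'`, when `t i = 1`. -/
noncomputable def extendAffine (φ : (Fin n → ℝ) →ᵃ[ℝ] (Fin m → ℝ)) (i : Fin n) (t : Fin n → ℝ)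
    (t' : Fin m → ℝ) : (Fin n → ℝ) →ᵃ[ℝ] (Fin m → ℝ) :=
  φ.comp (LinearMap.id - (LinearMap.proj i).smulRight t).toAffineMap +
    ((LinearMap.proj i).smulRight t').toAffineMap

theorem extendAffine_apply (φ : (Fin n → ℝ) →ᵃ[ℝ] (Fin m → ℝ)) (i : Fin n) (t : Fin n → ℝ)
    (t' : Fin m → ℝ) (x : Fin n → ℝ) :
    extendAffine φ i t t' x = φ (x - x i • t) + x i • t' := by
  simp [extendAffine]

theorem extendAffine_of_eq_zero (φ : (Fin n → ℝ) →ᵃ[ℝ] (Fin m → ℝ)) {i : Fin n} (t : Fin n → ℝ)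
    (t' : Fin m → ℝ) {x : Fin n → ℝ} (hx : x i = 0) : extendAffine φ i t t' x = φ x := by
  simp [extendAffine_apply, hx]

theorem extendAffine_of_eq_one (φ : (Fin n → ℝ) →ᵃ[ℝ] (Fin m → ℝ)) {i : Fin n} {t : Fin n → ℝ}
    (t' : Fin m → ℝ) {x : Fin n → ℝ} (hx : (t + x) i = 1) :
    extendAffine φ i t t' (t + x) = t' + φ x := by
  rw [extendAffine_apply, hx, one_smul, one_smul, add_sub_cancel_left, add_comm]

theorem AffIso.convexHull {P : Set (Fin n → ℝ)} {Q : Set (Fin m → ℝ)}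
    {φ : (Fin n → ℝ) →ᵃ[ℝ] (Fin m → ℝ)} {ψ : (Fin m → ℝ) →ᵃ[ℝ] (Fin n → ℝ)}
    (h : AffIso P Q φ ψ) : AffIso (convexHull ℝ P) (convexHull ℝ Q) φ ψ := by
  refine ⟨by rw [AffineMap.image_convexHull, h.1], fun x hx => ?_⟩
  have h1 : _root_.convexHull ℝ P ⊆ (ψ.comp φ - AffineMap.id ℝ (Fin n → ℝ)) ⁻¹' {0} :=
    convexHull_min (fun x hx => by simp [h.2 x hx]) ((convex_singleton (0 : Fin n → ℝ)).affine_preimage _)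
  simpa [sub_eq_zero] using h1 hx

/-- An affine isomorphism of the bases that matches the chosen subsets extends to an affine
isomorphism of the suspensions. -/
theorem AffIso.suspend {P₀ F : Set (Fin n → ℝ)} {Q₀ : Set (Fin m → ℝ)}
    {φ : (Fin n → ℝ) →ᵃ[ℝ] (Fin m → ℝ)} {ψ : (Fin m → ℝ) →ᵃ[ℝ] (Fin n → ℝ)}
    (h : AffIso P₀ Q₀ φ ψ) (hF : F ⊆ P₀) {i : Fin n} {i' : Fin m} {t : Fin n → ℝ} {t' : Fin m → ℝ}
    (hP₀ : ∀ x ∈ P₀, x i = 0) (hP₁ : ∀ x ∈ F, (t + x) i = 1)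
    (hQ₀ : ∀ x ∈ Q₀, x i' = 0) (hQ₁ : ∀ x ∈ φ '' F, (t' + x) i' = 1) :
    AffIso (suspend P₀ F t) (suspend Q₀ (φ '' F) t') (extendAffine φ i t t')
      (extendAffine ψ i' t' t) := by
  refine AffIso.convexHull ⟨?_, ?_⟩
  · rw [Set.image_union, ← h.1, Set.image_image, Set.image_image]
    congr 1
    · exact Set.image_congr fun x hx => extendAffine_of_eq_zero φ t t' (hP₀ x hx)
    · exact Set.image_congr fun x hx => extendAffine_of_eq_one φ t' (hP₁ x hx)
  · rintro _ (hx | ⟨x, hx, rfl⟩)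
    · rw [extendAffine_of_eq_zero φ t t' (hP₀ _ hx),
        extendAffine_of_eq_zero ψ t' t (hQ₀ _ (h.1 ▸ Set.mem_image_of_mem φ hx)), h.2 _ hx]
    · beta_reduce
      rw [extendAffine_of_eq_one φ t' (hP₁ x hx),
        extendAffine_of_eq_one ψ t (hQ₁ _ (Set.mem_image_of_mem φ hx)), h.2 _ (hF hx)]

section Base

variable {P₀ F : Set (Fin n → ℝ)} {i : Fin n} {t : Fin n → ℝ}

theorem vectorSpan_suspend (hF : F ⊆ P₀) (hne : F.Nonempty) :
    vectorSpan ℝ (suspend P₀ F t) = vectorSpan ℝ P₀ ⊔ Submodule.span ℝ {t} := by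
  obtain ⟨x₀, hx₀⟩ := hne
  rw [suspend, ← direction_affineSpan, affineSpan_convexHull, direction_affineSpan]
  apply le_antisymm
  · rw [vectorSpan_eq_span_vsub_set_right ℝ (Set.mem_union_left _ (hF hx₀)), Submodule.span_le]
    rintro _ ⟨_, hx | ⟨x, hx, rfl⟩, rfl⟩
    · exact Submodule.mem_sup_left (vsub_mem_vectorSpan ℝ hx (hF hx₀))
    · have : (t + x) -ᵥ x₀ = (x -ᵥ x₀) + t := by
        simp only [vsub_eq_sub]
        abel
      change (t + x) -ᵥ x₀ ∈ _
      rw [this]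
      exact Submodule.add_mem_sup (vsub_mem_vectorSpan ℝ (hF hx) (hF hx₀))
        (Submodule.mem_span_singleton_self t)
  · refine sup_le (vectorSpan_mono ℝ Set.subset_union_left) ?_
    rw [Submodule.span_singleton_le_iff_mem]
    have := vsub_mem_vectorSpan ℝ (s := P₀ ∪ (fun x => t + x) '' F)
      (Set.mem_union_right _ ⟨x₀, hx₀, rfl⟩) (Set.mem_union_left _ (hF hx₀))
    simpa using this

theorem notMem_vectorSpan_of_coord {S : Set (Fin n → ℝ)} (hS : ∀ x ∈ S, x i = 0)
    {u : Fin n → ℝ} (hu : u i = 1) : u ∉ vectorSpan ℝ S := by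
  intro h
  have h1 : vectorSpan ℝ S ≤ LinearMap.ker
      ((LinearMap.proj i : (Fin n → ℝ) →ₗ[ℝ] ℝ).toAffineMap.linear) :=
    vectorSpan_le_ker (c := 0) hS
  have h2 : u i = 0 := h1 h
  rw [hu] at h2
  exact one_ne_zero h2

theorem finrank_suspend (hF : F ⊆ P₀) (hne : F.Nonempty) (hP₀ : ∀ x ∈ P₀, x i = 0)
    (hP₁ : ∀ x ∈ F, (t + x) i = 1) :
    Module.finrank ℝ (vectorSpan ℝ (suspend P₀ F t)) = Module.finrank ℝ (vectorSpan ℝ P₀) + 1 := by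
  rw [vectorSpan_suspend hF hne]
  refine Submodule.finrank_sup_span_singleton (notMem_vectorSpan_of_coord hP₀ ?_)
  obtain ⟨x₀, hx₀⟩ := hne
  simpa [hP₀ x₀ (hF hx₀)] using hP₁ x₀ hx₀

/-- The base is the face of the suspension in the hyperplane `{x | x i = 0}`, so its vertices are
vertices of the suspension. -/
theorem extremePoints_base_subset (hP₀c : IsPolytope P₀) (hP : IsPolytope (suspend P₀ F t))
    (hP₀ : ∀ x ∈ P₀, x i = 0) (hP₁ : ∀ x ∈ F, (t + x) i = 1) :
    P₀.extremePoints ℝ ⊆ (suspend P₀ F t).extremePoints ℝ := by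
  let g : (Fin n → ℝ) →ᵃ[ℝ] ℝ := (LinearMap.proj i : (Fin n → ℝ) →ₗ[ℝ] ℝ).toAffineMap
  have hg : ∀ x ∈ suspend P₀ F t, 0 ≤ g x := by
    intro x hx
    refine convexHull_min ?_ ((convex_Ici (0 : ℝ)).affine_preimage g) hx
    rintro _ (hx | ⟨x, hx, rfl⟩)
    · exact (hP₀ _ hx).ge
    · exact zero_le_one.trans (hP₁ x hx).ge
  have hface := isFace_of_affine hg
  have heq : {x ∈ suspend P₀ F t | g x = 0} = P₀ := by
    refine Set.Subset.antisymm ?_ fun x hx => ⟨subset_convexHull ℝ _ (Or.inl hx), hP₀ x hx⟩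
    rw [← hface.convexHull_inter hP]
    refine convexHull_min ?_ hP₀c.convex
    rintro x ⟨⟨-, hx0⟩, hx⟩
    rcases extremePoints_convexHull_subset hx with h | ⟨y, hy, rfl⟩
    · exact h
    · have h1 : (t + y) i = 0 := hx0
      rw [hP₁ y hy] at h1
      exact absurd h1 one_ne_zero
  rw [heq] at hface
  exact hface.isExtreme.extremePoints_subset_extremePoints

/-- The base of a 2-level suspension is 2-level. A facet-defining form of the base is extended to
the suspension so that it becomes tight at the translate of a point of `F` where it is smallest;
the extension defines a facet. -/
theorem IsTwoLevel.base (hP₀c : IsPolytope P₀) (hF : IsFace P₀ F) (hne : F.Nonempty)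
    (hP : IsPolytope (suspend P₀ F t)) (hP₀ : ∀ x ∈ P₀, x i = 0) (hP₁ : ∀ x ∈ F, (t + x) i = 1)
    (h2 : IsTwoLevel (suspend P₀ F t)) : IsTwoLevel P₀ := by
  intro g hg hfac
  have hP₀ne : P₀.Nonempty := hne.mono hF.subset
  have hfin := finrank_suspend hF.subset hne hP₀ hP₁
  rcases Set.eq_empty_or_nonempty {x ∈ P₀ | g x = 0} with hemp | ⟨y, hy⟩
  · -- The empty set is a facet only of a point.
    have hd := hfac.2
    rw [hemp, dim_empty, dim_eq_finrank hP₀ne] at hd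
    have h0 : vectorSpan ℝ P₀ = ⊥ := Submodule.finrank_eq_zero.1 (by omega)
    obtain ⟨y, hy⟩ := hP₀ne
    refine ⟨g y, fun v hv _ => ?_⟩
    have h1 : v -ᵥ y ∈ vectorSpan ℝ P₀ := vsub_mem_vectorSpan ℝ hv.1 hy
    rw [h0, Submodule.mem_bot, vsub_eq_zero_iff_eq] at h1
    rw [h1]
  obtain ⟨f₀, hf₀, hmin⟩ := (hF.isCompact hP₀c.isCompact).exists_isMinOn hne
    (g.continuous_of_finiteDimensional).continuousOn
  have hmin' : ∀ x ∈ F, g f₀ ≤ g x := hmin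
  let proj : (Fin n → ℝ) →ₗ[ℝ] ℝ := LinearMap.proj i
  let g' : (Fin n → ℝ) →ᵃ[ℝ] ℝ :=
    g.comp (LinearMap.id - proj.smulRight t).toAffineMap - (g f₀ • proj).toAffineMap
  have hg' : ∀ x, g' x = g (x - x i • t) - g f₀ * x i := fun x => rfl
  have hbase : ∀ x ∈ P₀, g' x = g x := fun x hx => by rw [hg', hP₀ x hx]; simp
  have htop : ∀ x ∈ F, g' (t + x) = g x - g f₀ := fun x hx => by
    rw [hg', hP₁ x hx, one_smul, add_sub_cancel_left, mul_one]
  have hnonneg : ∀ x ∈ suspend P₀ F t, 0 ≤ g' x := by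
    intro x hx
    refine convexHull_min ?_ ((convex_Ici (0 : ℝ)).affine_preimage g') hx
    rintro _ (hx | ⟨x, hx, rfl⟩)
    · exact (hg _ hx).trans (hbase _ hx).ge
    · exact (sub_nonneg.2 (hmin' x hx)).trans (htop x hx).ge
  have hsub : P₀ ⊆ suspend P₀ F t := fun x hx => subset_convexHull ℝ _ (Or.inl hx)
  have hface := isFace_of_affine hnonneg
  have hymem : y ∈ {x ∈ suspend P₀ F t | g' x = 0} :=
    ⟨hsub hy.1, (hbase y hy.1).trans hy.2⟩
  have hproper : {x ∈ suspend P₀ F t | g' x = 0} ≠ suspend P₀ F t := by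
    intro h
    refine hfac.ne (Set.Subset.antisymm (fun x hx => hx.1) fun x hx => ⟨hx, ?_⟩)
    have h1 := hsub hx
    rw [← h] at h1
    rw [← hbase x hx, h1.2]
  have hlt := hface.finrank_lt ⟨y, hymem⟩ hproper
  have htf : t + f₀ ∈ {x ∈ suspend P₀ F t | g' x = 0} :=
    ⟨subset_convexHull ℝ _ (Or.inr ⟨f₀, hf₀, rfl⟩), by rw [htop f₀ hf₀, sub_self]⟩
  have hlow : Module.finrank ℝ (vectorSpan ℝ {x ∈ P₀ | g x = 0}) + 1 ≤
      Module.finrank ℝ (vectorSpan ℝ {x ∈ suspend P₀ F t | g' x = 0}) := by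
    have hnot : (t + f₀) -ᵥ y ∉ vectorSpan ℝ {x ∈ P₀ | g x = 0} := by
      refine notMem_vectorSpan_of_coord (i := i) (fun x hx => hP₀ x hx.1) ?_
      rw [vsub_eq_sub, Pi.sub_apply, hP₁ f₀ hf₀, hP₀ y hy.1, sub_zero]
    rw [← Submodule.finrank_sup_span_singleton hnot]
    refine Submodule.finrank_mono (sup_le (vectorSpan_mono ℝ fun x hx => ?_) ?_)
    · exact ⟨hsub hx.1, (hbase x hx.1).trans hx.2⟩
    · rw [Submodule.span_singleton_le_iff_mem]
      exact vsub_mem_vectorSpan ℝ htf hymem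
  have hfac' : IsFacet (suspend P₀ F t) {x ∈ suspend P₀ F t | g' x = 0} := by
    refine ⟨hface, ?_⟩
    have hd := hfac.2
    rw [dim_eq_finrank ⟨y, hy⟩, dim_eq_finrank hP₀ne] at hd
    rw [dim_eq_finrank ⟨y, hymem⟩, dim_eq_finrank (hP₀ne.mono hsub)]
    omega
  obtain ⟨s, hs⟩ := h2 g' hnonneg hfac'
  refine ⟨s, fun v hv hgv => ?_⟩
  rw [← hbase v hv.1] at hgv ⊢
  exact hs v (extremePoints_base_subset hP₀c hP hP₀ hP₁ hv) hgv

end Base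

/-! ### Counting -/

theorem exists_cube_representative {τ : CombType} (hτ : τ ∈ twoLevelTypes d) :
    ∃ T : Set (Fin d → Bool), ∀ P : Polytope, Quotient.mk combSetoid P = τ →
      dim P.carrier = d → IsTwoLevel P.carrier →
      ∃ φ ψ, AffIso P.carrier (cubeHull T) φ ψ := by
  obtain ⟨Q, ⟨hQd, hQ⟩, rfl⟩ := hτ
  obtain ⟨T, φ, ψ, h⟩ := hQ.exists_affIso_cubeHull Q.isPolytope hQd
  refine ⟨T, fun P hPQ hPd hP => ?_⟩
  obtain ⟨φ', ψ', h'⟩ := exists_affIso_of_combEquiv hP hQ hPd hQd hPQ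
  exact ⟨_, _, h'.trans h⟩

theorem finite_twoLevelTypes (d : ℕ) : (twoLevelTypes d).Finite := by
  refine (Set.finite_range fun T : Set (Fin d → Bool) =>
    Quotient.mk combSetoid ⟨d, cubeHull T, isPolytope_cubeHull T⟩).subset ?_
  rintro _ ⟨P, ⟨hPd, hP⟩, rfl⟩
  obtain ⟨T, φ, ψ, h⟩ := hP.exists_affIso_cubeHull P.isPolytope hPd
  exact ⟨T, (combEquiv_of_affIso (Q := ⟨d, cubeHull T, isPolytope_cubeHull T⟩) h).symm⟩

theorem suspensionTypes_subset (d : ℕ) : suspensionTypes d ⊆ twoLevelTypes d :=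
  Set.image_mono fun _ hP => ⟨hP.1, hP.2.1⟩

theorem ell_zero_le : ell 0 ≤ 1 := by
  rw [ell, Set.ncard_le_one (finite_twoLevelTypes 0)]
  rintro _ ⟨P, ⟨hPd, hP⟩, rfl⟩ _ ⟨Q, ⟨hQd, hQ⟩, rfl⟩
  have key : ∀ R : Polytope, dim R.carrier = (0 : ℕ) → IsTwoLevel R.carrier →
      ∃ φ ψ, AffIso R.carrier (Set.univ : Set (Fin 0 → ℝ)) φ ψ := by
    intro R hd hR
    obtain ⟨T, φ, ψ, h⟩ := hR.exists_affIso_cubeHull R.isPolytope hd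
    have hne : R.carrier.Nonempty := by
      by_contra hcon
      rw [Set.not_nonempty_iff_eq_empty] at hcon
      rw [hcon, dim_empty] at hd
      omega
    have : cubeHull T = Set.univ := Subsingleton.eq_univ_of_nonempty (h.1 ▸ hne.image φ)
    exact ⟨φ, ψ, this ▸ h⟩
  obtain ⟨φ, ψ, h⟩ := key P hPd hP
  obtain ⟨φ', ψ', h'⟩ := key Q hQd hQ
  exact combEquiv_of_affIso (h.trans h'.symm)

/-- The combinatorial type `σ` is that of a suspension whose base is affinely isomorphic to the 0/1
polytope on `T`, in such a way that the chosen face of the base corresponds to the section by the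
affine hull of the 0/1 points `f`. -/
def IsSuspensionCode (T : Set (Fin d → Bool)) (f : Fin (d + 1) → (Fin d → Bool))
    (σ : CombType) : Prop :=
  ∃ P : Polytope, Quotient.mk combSetoid P = σ ∧
    ∃ (i : Fin P.n) (P₀ F : Set (Fin P.n → ℝ)) (t : Fin P.n → ℝ) (φ : _) (ψ : _),
      F ⊆ P₀ ∧ (∀ x ∈ P₀, x i = 0) ∧ (∀ x ∈ F, (t + x) i = 1) ∧ P.carrier = suspend P₀ F t ∧
      AffIso P₀ (cubeHull T) φ ψ ∧
      φ '' F = cubeHull T ∩ affineSpan ℝ (Set.range (cubePoint ∘ f))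

theorem IsSuspensionCode.unique {T : Set (Fin d → Bool)} {f : Fin (d + 1) → (Fin d → Bool)}
    {σ σ' : CombType} (h : IsSuspensionCode T f σ) (h' : IsSuspensionCode T f σ') : σ = σ' := by
  obtain ⟨P, rfl, i, P₀, F, t, φ, ψ, hF, hP₀, hP₁, hP, hiso, hface⟩ := h
  obtain ⟨P', rfl, i', P₀', F', t', φ', ψ', hF', hP₀', hP₁', hP', hiso', hface'⟩ := h'
  have himage : (ψ'.comp φ) '' F = F' := by
    rw [AffineMap.coe_comp, Set.image_comp, hface, ← hface', hiso'.symm_image hF']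
  have key := (hiso.trans hiso'.symm).suspend hF hP₀ hP₁ hP₀' (t' := t') (by rwa [himage])
  rw [himage, ← hP, ← hP'] at key
  exact combEquiv_of_affIso key

theorem exists_isSuspensionCode {T : CombType → Set (Fin d → Bool)}
    (hT : ∀ τ ∈ twoLevelTypes d, ∀ P : Polytope, Quotient.mk combSetoid P = τ →
      dim P.carrier = d → IsTwoLevel P.carrier → ∃ φ ψ, AffIso P.carrier (cubeHull (T τ)) φ ψ)
    {σ : CombType} (hσ : σ ∈ suspensionTypes (d + 1)) :
    ∃ p : CombType × (Fin (d + 1) → (Fin d → Bool)),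
      p.1 ∈ twoLevelTypes d ∧ IsSuspensionCode (T p.1) p.2 σ := by
  obtain ⟨P, ⟨hPd, hP2, i, -, P₀, P₁, F, t, hP₀c, hP₀, hF, hne, rfl, hP₁, hP⟩, rfl⟩ := hσ
  have hP₁' : ∀ x ∈ F, (t + x) i = 1 := fun x hx => hP₁ ⟨x, hx, rfl⟩
  have hP' : P.carrier = suspend P₀ F t := hP
  have hPpoly := P.isPolytope
  rw [hP'] at hPpoly hP2 hPd
  have hsub : P₀ ⊆ suspend P₀ F t := fun x hx => subset_convexHull ℝ _ (Or.inl hx)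
  have hP₀ne : P₀.Nonempty := hne.mono hF.subset
  have h2 : IsTwoLevel P₀ := hP2.base hP₀c hF hne hPpoly hP₀ hP₁'
  have hd : dim P₀ = d := by
    rw [dim_eq_finrank (hP₀ne.mono hsub), finrank_suspend hF.subset hne hP₀ hP₁'] at hPd
    rw [dim_eq_finrank hP₀ne]
    omega
  let B : Polytope := ⟨P.n, P₀, hP₀c⟩
  have hB : Quotient.mk combSetoid B ∈ twoLevelTypes d := ⟨B, ⟨hd, h2⟩, rfl⟩
  obtain ⟨φ, ψ, hiso⟩ := hT _ hB B rfl hd h2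
  obtain ⟨f, hf⟩ := exists_face_eq_inter_affineSpan (hiso.isFace_image hF) (hne.image φ)
  exact ⟨(Quotient.mk combSetoid B, f), hB, P, rfl, i, P₀, F, t, φ, ψ, hF.subset, hP₀, hP₁', hP',
    hiso, hf⟩

/-- A suspension is determined by its base and a face of the base, so there are at most as many as
2-level polytopes of one dimension less, times the number of faces that these can have. -/
theorem susp_succ_le (d : ℕ) : susp (d + 1) ≤ ell d * 2 ^ (d * (d + 1)) := by
  have : Nonempty CombType :=
    ⟨Quotient.mk combSetoid ⟨0, _, isPolytope_convexHull Set.finite_empty⟩⟩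
  have hT : ∀ τ : CombType, ∃ T : Set (Fin d → Bool), τ ∈ twoLevelTypes d →
      ∀ P : Polytope, Quotient.mk combSetoid P = τ → dim P.carrier = d →
        IsTwoLevel P.carrier → ∃ φ ψ, AffIso P.carrier (cubeHull T) φ ψ := by
    intro τ
    by_cases hτ : τ ∈ twoLevelTypes d
    · obtain ⟨T, hT⟩ := exists_cube_representative hτ
      exact ⟨T, fun _ => hT⟩
    · exact ⟨∅, fun h => absurd h hτ⟩
  choose T hT using hT
  have hcode : ∀ σ : CombType, ∃ p : CombType × (Fin (d + 1) → (Fin d → Bool)),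
      σ ∈ suspensionTypes (d + 1) → p.1 ∈ twoLevelTypes d ∧ IsSuspensionCode (T p.1) p.2 σ := by
    intro σ
    by_cases hσ : σ ∈ suspensionTypes (d + 1)
    · obtain ⟨p, hp⟩ := exists_isSuspensionCode hT hσ
      exact ⟨p, fun _ => hp⟩
    · exact ⟨Classical.arbitrary _, fun h => absurd h hσ⟩
  choose p hp using hcode
  calc susp (d + 1) ≤ (twoLevelTypes d ×ˢ
        (Set.univ : Set (Fin (d + 1) → (Fin d → Bool)))).ncard := by
        refine Set.ncard_le_ncard_of_injOn p (fun σ hσ => ⟨(hp σ hσ).1, trivial⟩) ?_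
          ((finite_twoLevelTypes d).prod Set.finite_univ)
        intro σ hσ σ' hσ' hpp
        have h := (hp σ hσ).2
        rw [hpp] at h
        exact h.unique (hp σ' hσ').2
    _ = ell d * 2 ^ (d * (d + 1)) := by
        rw [Set.ncard_prod, Set.ncard_univ, Nat.card_eq_fintype_card]
        simp [ell, pow_mul]

/-! ### The growth of the number of 2-level polytopes -/

/-- The growth estimate for abstract sequences. The base `c` absorbs the constant of `hO` and the
finitely many `d` where its inequality may fail; `h0` is needed because `c ^ 0 ^ 3 = 1`. -/
theorem exists_cubic_bound {a b : ℕ → ℕ} (h0 : a 0 ≤ 1)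
    (hstep : ∀ d, b (d + 1) ≤ a d * 2 ^ (d * (d + 1)))
    (hO : (fun d => (a d : ℝ)) =O[Filter.atTop] fun d => (b d : ℝ)) :
    ∃ c : ℕ, 1 < c ∧ ∀ d, a d ≤ c ^ d ^ 3 := by
  obtain ⟨C, hC⟩ := hO.bound
  obtain ⟨N, hN⟩ := Filter.eventually_atTop.1 hC
  let M : ℕ := ⌈C⌉₊ + ∑ d ∈ Finset.range (N + 1), a d + 1
  have hCM : C ≤ M := (Nat.le_ceil C).trans (by
    exact_mod_cast (Nat.le_add_right _ _).trans (Nat.le_add_right _ _))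
  have hab : ∀ d, N ≤ d → a d ≤ M * b d := by
    intro d hd
    have h1 := hN d hd
    rw [Real.norm_natCast, Real.norm_natCast] at h1
    have h2 : (a d : ℝ) ≤ M * b d := h1.trans (by gcongr)
    exact_mod_cast h2
  have hsmall : ∀ d, d ≤ N → a d ≤ M := by
    intro d hd
    have : a d ≤ ∑ d ∈ Finset.range (N + 1), a d :=
      Finset.single_le_sum (fun _ _ => Nat.zero_le _) (Finset.mem_range.2 (by omega))
    exact this.trans ((Nat.le_add_left _ _).trans (Nat.le_add_right _ _))
  have hM : 1 ≤ M := Nat.le_add_left _ _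
  refine ⟨2 * M, by omega, fun d => ?_⟩
  have hpos : 0 < 2 * M := by omega
  induction d with
  | zero => simpa using h0
  | succ d ih =>
    rcases le_or_gt (d + 1) N with hd | hd
    · exact (hsmall _ hd).trans ((Nat.le_mul_of_pos_left M two_pos).trans
        (Nat.le_self_pow (by positivity) _))
    · calc a (d + 1) ≤ M * b (d + 1) := hab _ hd.le
        _ ≤ M * (a d * 2 ^ (d * (d + 1))) := Nat.mul_le_mul_left _ (hstep d)
        _ ≤ (2 * M) ^ 1 * ((2 * M) ^ d ^ 3 * (2 * M) ^ (d * (d + 1))) := by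
            gcongr
            · rw [pow_one]; omega
            · omega
        _ = (2 * M) ^ (1 + (d ^ 3 + d * (d + 1))) := by rw [← pow_add, ← pow_add]
        _ ≤ (2 * M) ^ (d + 1) ^ 3 := Nat.pow_le_pow_right hpos (by nlinarith)

end TwoLevel

theorem mainTheorem9 :
    (∀ d : ℕ, (TwoLevel.twoLevelTypes d).Finite ∧ (TwoLevel.suspensionTypes d).Finite) ∧
    (Asymptotics.IsTheta Filter.atTop
        (fun d : ℕ => (TwoLevel.ell d : ℝ)) (fun d : ℕ => (TwoLevel.susp d : ℝ)) →
      (∃ c : ℝ, 1 < c ∧ ∀ d : ℕ, (TwoLevel.ell d : ℝ) ≤ c ^ (d ^ 3)) ∧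
      (∃ p : Polynomial ℕ, ∀ d : ℕ, TwoLevel.ell d ≤ 2 ^ (p.eval d))) := by
  refine ⟨fun d => ⟨TwoLevel.finite_twoLevelTypes d,
    (TwoLevel.finite_twoLevelTypes d).subset (TwoLevel.suspensionTypes_subset d)⟩, fun h => ?_⟩
  obtain ⟨c, hc, hle⟩ := TwoLevel.exists_cubic_bound TwoLevel.ell_zero_le TwoLevel.susp_succ_le h.1
  refine ⟨⟨c, by exact_mod_cast hc, fun d => by exact_mod_cast hle d⟩,
    Polynomial.C c * Polynomial.X ^ 3, fun d => (hle d).trans ?_⟩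
  have h1 : c ^ d ^ 3 ≤ (2 ^ c) ^ d ^ 3 := Nat.pow_le_pow_left c.lt_two_pow_self.le _
  simpa [pow_mul] using h1
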